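/- **Setting.** Let $T,d\in\mathbb N$ and let $\Omega_1,\dots,\Omega_T$ be Polish spaces; put $\Omega^0=$ a one-point space and $\Omega^t=\Omega_1\times\dots\times\Omega_t$. For a Polish space $X$, $\mathcal B(X)$ is the Borel $\sigma$-algebra, $\mathfrak P(X)$ the space of Borel probability measures with the weak topology, and $\mathcal B_c(X)=\bigcap_{P\in\mathfrak P(X)}\mathcal B_P(X)$ the universal $\sigma$-algebra ($\mathcal B_P(X)$ is the $P$-completion of $\mathcal B(X)$). For $\mathcal P\subset\mathfrak P(X)$, a set $N\subset X$ is $\mathcal P$-polar if every $P\in\mathcal P$ has some $A_P\in\mathcal B_c(X)$ with $P(A_P)=0$ and $N\subset A_P$; a property holds $\mathcal P$-quasi-surely (q.s.) if it holds outside a $\mathcal P$-polar set; a set is of $\mathcal P$-full measure if its complement is $\mathcal P$-polar. For $0\le t\le T-1$ and $\omega^t\in\Omega^t$ let $\mathcal Q_{t+1}(\omega^t)\subset\mathfrak P(\Omega_{t+1})$. Let $\mathcal Q^0$ consist of the unique probability measure on $\Omega^0$, and for $0\le t\le T-1$ let $\mathcal Q^{t+1}$ be the set of all $Q\otimes q$,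 where $Q\in\mathcal Q^t$ and $q$ is a universally measurable stochastic kernel on $\Omega_{t+1}$ given $\Omega^t$ with $q(\cdot,\omega^t)\in\mathcal Q_{t+1}(\omega^t)$ for $Q$-almost every $\omega^t$; here $Q\otimes q(A)=\int_{\Omega^t}\int_{\Omega_{t+1}}1_A(\omega^t,\omega_{t+1})\,q(d\omega_{t+1},\omega^t)\,Q(d\omega^t)$. Let $S_t:\Omega^t\to\mathbb R^d$, $0\le t\le T$, and $\Delta S_{t+1}(\omega^t,\omega_{t+1})=S_{t+1}(\omega^t,\omega_{t+1})-S_t(\omega^t)$. Juxtaposition $hy$ denotes the scalar product and $|\cdot|$ the Euclidean norm on $\mathbb R^d$. The condition $NA(\mathcal Q^T)$ says: for every strategy $\phi=(\phi_s)_{1\le s\le T}$ with $\phi_s:\Omega^{s-1}\to\mathbb R^d$ universally measurable, if $\sum_{s=1}^T\phi_s\Delta S_s\ge 0$ $\mathcal Q^T$-q.s., then $\sum_{s=1}^T\phi_s\Delta S_s=0$ $\mathcal Q^T$-q.s. For $\omega^t\in\Omega^t$, the condition $NA(\mathcal Q_{t+1}(\omega^t))$ says: for every $h\in\mathbb R^d$,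 if $h\Delta S_{t+1}(\omega^t,\cdot)\ge0$ $\mathcal Q_{t+1}(\omega^t)$-q.s., then $h\Delta S_{t+1}(\omega^t,\cdot)=0$ $\mathcal Q_{t+1}(\omega^t)$-q.s. Finally $$D^{t+1}(\omega^t)=\mathrm{Aff}\Big(\bigcap\big\{A\subset\mathbb R^d\text{ closed}:\ P(\Delta S_{t+1}(\omega^t,\cdot)\in A)=1\ \ \forall P\in\mathcal Q_{t+1}(\omega^t)\big\}\Big),$$ where $\mathrm{Aff}$ denotes the affine hull. **Proposition 2.2.** Assume $NA(\mathcal Q^T)$. Assume also that for all $0\le t\le T-1$ the sets $\mathcal Q_{t+1}(\omega^t)$ are non-empty and convex and the graph $\{(\omega^t,P):P\in\mathcal Q_{t+1}(\omega^t)\}$ is an analytic subset of $\Omega^t\times\mathfrak P(\Omega_{t+1})$, and that every $S_t$, $0\le t\le T$, is Borel measurable. Then for every $0\le t\le T-1$ there is a $\mathcal Q^t$-full-measure set $\Omega^t_{NA}\in\mathcal B_c(\Omega^t)$ such that for all $\omega^t\in\Omega^t_{NA}$: $NA(\mathcal Q_{t+1}(\omega^t))$ holds; $D^{t+1}(\omega^t)$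 is a vector subspace of $\mathbb R^d$; and there is $\alpha_t(\omega^t)>0$ such that for every $h\in D^{t+1}(\omega^t)$ with $h\neq0$ there is $P_h\in\mathcal Q_{t+1}(\omega^t)$ with $$P_h\Big(\frac{h}{|h|}\,\Delta S_{t+1}(\omega^t,\cdot)<-\alpha_t(\omega^t)\Big)>\alpha_t(\omega^t).$$ -/

import Mathlib

open MeasureTheory Set
open scoped NNReal ENNReal RealInnerProductSpace

universe u v

namespace RobustMarket

/-! ### The universal sigma-algebra and polar sets -/

/-- The universal sigma-algebra `B_c(X)`: the intersection, over all probability measures `P` on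
`X`, of the `P`-completions of the given sigma-algebra. -/
@[reducible] def univSigma (X : Type u) [MeasurableSpace X] : MeasurableSpace X where
  MeasurableSet' s := ∀ P : ProbabilityMeasure X, NullMeasurableSet s (P : Measure X)
  measurableSet_empty _ := nullMeasurableSet_empty
  measurableSet_compl _ hs P := (hs P).compl
  measurableSet_iUnion _ hf P := NullMeasurableSet.iUnion fun i => hf i P

theorem le_univSigma (X : Type u) [m : MeasurableSpace X] : m ≤ univSigma X :=
  fun _ hs _ => MeasurableSet.nullMeasurableSet hs

/-- `N` is polar for the family `𝓟`: it is null for every `P ∈ 𝓟`. (The value `P N` is the outer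
measure of `N`, so `P N = 0` says that `N` lies in a null set; see `isPolar_iff`.) -/
def IsPolar {X : Type u} [MeasurableSpace X] (𝓟 : Set (ProbabilityMeasure X)) (N : Set X) : Prop :=
  ∀ P ∈ 𝓟, (P : Measure X) N = 0

theorem isPolar_iff {X : Type u} [MeasurableSpace X] (𝓟 : Set (ProbabilityMeasure X)) (N : Set X) :
    IsPolar 𝓟 N ↔ ∀ P ∈ 𝓟, ∃ A : Set X, MeasurableSet[univSigma X] A ∧ (P : Measure X) A = 0 ∧
      N ⊆ A := by
  refine forall₂_congr fun P _ => ⟨fun h => ?_, ?_⟩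
  · obtain ⟨A, hA, hm, h0⟩ := exists_measurable_superset_of_null h
    exact ⟨A, le_univSigma X A hm, h0, hA⟩
  · rintro ⟨A, -, h0, hA⟩
    exact measure_mono_null hA h0

/-- The property `p` holds `𝓟`-quasi-surely: outside a `𝓟`-polar set. -/
def QuasiSurely {X : Type u} [MeasurableSpace X] (𝓟 : Set (ProbabilityMeasure X))
    (p : X → Prop) : Prop :=
  IsPolar 𝓟 {x | ¬ p x}

/-! ### Universally measurable kernels and the product of a measure with a kernel -/

/-- Universally measurable stochastic kernels on `Y` given `X`. -/
structure UnivKernel (X : Type u) (Y : Type v) [MeasurableSpace X] [MeasurableSpace Y] where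
  toFun : X → ProbabilityMeasure Y
  measurable_toFun : Measurable[univSigma X] toFun

namespace UnivKernel

variable {X : Type u} {Y : Type v} [MeasurableSpace X] [MeasurableSpace Y]

theorem measurable_section (q : UnivKernel X Y) {A : Set (X × Y)} (hA : MeasurableSet A) :
    Measurable[univSigma X] fun x => (q.toFun x : Measure Y) {y | (x, y) ∈ A} := by
  let κ : @ProbabilityTheory.Kernel X Y (univSigma X) _ :=
    @ProbabilityTheory.Kernel.mk X Y (univSigma X) _ (fun x => (q.toFun x : Measure Y))
      (measurable_subtype_coe.comp q.measurable_toFun)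
  have hκ : @ProbabilityTheory.IsMarkovKernel X Y (univSigma X) _ κ :=
    @ProbabilityTheory.IsMarkovKernel.mk X Y (univSigma X) _ κ
      fun x => inferInstanceAs (IsProbabilityMeasure (q.toFun x : Measure Y))
  have hle : (Prod.instMeasurableSpace : MeasurableSpace (X × Y)) ≤
      @Prod.instMeasurableSpace X Y (univSigma X) _ :=
    sup_le_sup (MeasurableSpace.comap_mono (le_univSigma X)) le_rfl
  exact @ProbabilityTheory.Kernel.measurable_kernel_prodMk_left X Y (univSigma X) _ κ _ A
    (hle A hA)

theorem aemeasurable_section (q : UnivKernel X Y) (P : ProbabilityMeasure X) {A : Set (X × Y)}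
    (hA : MeasurableSet A) :
    AEMeasurable (fun x => (q.toFun x : Measure Y) {y | (x, y) ∈ A}) (P : Measure X) :=
  NullMeasurable.aemeasurable fun _ hB => q.measurable_section hA hB P

/-- The measure `P ⊗ q` as a measure: `A ↦ ∫ q(x)(A_x) P(dx)`. -/
noncomputable def prodMeasure (P : ProbabilityMeasure X) (q : UnivKernel X Y) : Measure (X × Y) :=
  Measure.ofMeasurable
    (fun A _ => ∫⁻ x, (q.toFun x : Measure Y) {y | (x, y) ∈ A} ∂(P : Measure X))
    (by simp)
    (by
      intro f hf hd
      rw [← lintegral_tsum fun i => q.aemeasurable_section P (hf i)]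
      refine lintegral_congr fun x => ?_
      have : {y | (x, y) ∈ ⋃ i, f i} = ⋃ i, {y | (x, y) ∈ f i} := by ext y; simp
      rw [this, measure_iUnion]
      · intro i j hij
        exact Set.disjoint_left.2 fun y h1 h2 => Set.disjoint_left.1 (hd hij) h1 h2
      · exact fun i => measurable_prodMk_left (hf i))

theorem prodMeasure_apply (P : ProbabilityMeasure X) (q : UnivKernel X Y) {A : Set (X × Y)}
    (hA : MeasurableSet A) :
    prodMeasure P q A = ∫⁻ x, (q.toFun x : Measure Y) {y | (x, y) ∈ A} ∂(P : Measure X) :=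
  Measure.ofMeasurable_apply A hA

/-- The probability measure `P ⊗ q`. -/
noncomputable def prod (P : ProbabilityMeasure X) (q : UnivKernel X Y) :
    ProbabilityMeasure (X × Y) :=
  ⟨prodMeasure P q, ⟨by simp [prodMeasure_apply P q MeasurableSet.univ]⟩⟩

end UnivKernel

/-! ### Path spaces -/

/-- The space of paths up to time `t`. The space of the `(n+1)`-th period is `Ω n`, so that
`Path Ω t = Ω 0 × ⋯ × Ω (t - 1)`; `Path Ω 0` is a one-point space. -/
@[reducible] def Path (Ω : ℕ → Type u) : ℕ → Type u
  | 0 => PUnit.{u + 1}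
  | t + 1 => Path Ω t × Ω t

section Instances

variable (Ω : ℕ → Type u)

instance instTopologicalSpacePath [∀ n, TopologicalSpace (Ω n)] :
    ∀ t, TopologicalSpace (Path Ω t)
  | 0 => inferInstanceAs (TopologicalSpace PUnit.{u + 1})
  | t + 1 =>
    letI := instTopologicalSpacePath t
    inferInstanceAs (TopologicalSpace (Path Ω t × Ω t))

instance instMeasurableSpacePath [∀ n, MeasurableSpace (Ω n)] :
    ∀ t, MeasurableSpace (Path Ω t)
  | 0 => inferInstanceAs (MeasurableSpace PUnit.{u + 1})
  | t + 1 =>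
    letI := instMeasurableSpacePath t
    inferInstanceAs (MeasurableSpace (Path Ω t × Ω t))

instance instPolishSpacePath [∀ n, TopologicalSpace (Ω n)] [∀ n, PolishSpace (Ω n)] :
    ∀ t, PolishSpace (Path Ω t)
  | 0 => inferInstanceAs (PolishSpace PUnit.{u + 1})
  | t + 1 =>
    letI := instPolishSpacePath t
    inferInstanceAs (PolishSpace (Path Ω t × Ω t))

instance instBorelSpacePath [∀ n, TopologicalSpace (Ω n)] [∀ n, PolishSpace (Ω n)]
    [∀ n, MeasurableSpace (Ω n)] [∀ n, BorelSpace (Ω n)] :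
    ∀ t, BorelSpace (Path Ω t)
  | 0 => inferInstanceAs (BorelSpace PUnit.{u + 1})
  | t + 1 =>
    letI := instBorelSpacePath t
    inferInstanceAs (BorelSpace (Path Ω t × Ω t))

end Instances

/-- The path `(ω, w)` that continues the path `ω` with the outcome `w`. -/
def Path.snoc {Ω : ℕ → Type u} {t : ℕ} (ω : Path Ω t) (w : Ω t) : Path Ω (t + 1) := (ω, w)

/-! ### The models `𝒬^t` -/

section Models

variable {Ω : ℕ → Type u} [∀ n, MeasurableSpace (Ω n)]

/-- The set `𝒬^t` of models up to time `t`, where `𝒬 t ω` is the set of models of the period from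
`t` to `t + 1` given the path `ω`: all products `Q ⊗ q` with `Q` in the set for the previous date
and `q` a universally measurable kernel with `q(ω) ∈ 𝒬 t ω` for `Q`-almost every `ω`. At date `0`
the only model is the point mass on the one-point space. -/
def models (𝒬 : ∀ t, Path Ω t → Set (ProbabilityMeasure (Ω t))) :
    ∀ t, Set (ProbabilityMeasure (Path Ω t))
  | 0 => {⟨Measure.dirac PUnit.unit, Measure.dirac.isProbabilityMeasure⟩}
  | t + 1 => {R | ∃ Q ∈ models 𝒬 t, ∃ q : UnivKernel (Path Ω t) (Ω t),
      (∀ᵐ ω ∂(Q : Measure (Path Ω t)), q.toFun ω ∈ 𝒬 t ω) ∧ R = UnivKernel.prod Q q}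

/-- The sets `𝒬 t ω`, `t < T`, are non-empty and convex, and the graph of `𝒬 t` is an analytic
subset of the product of the path space with the space of probability measures, the latter with
the weak topology. -/
def AnalyticModels [∀ n, TopologicalSpace (Ω n)] [∀ n, BorelSpace (Ω n)] (T : ℕ)
    (𝒬 : ∀ t, Path Ω t → Set (ProbabilityMeasure (Ω t))) : Prop :=
  ∀ t < T,
    (∀ ω, (𝒬 t ω).Nonempty) ∧
    (∀ ω, Convex ℝ≥0 ((fun P : ProbabilityMeasure (Ω t) => (P : Measure (Ω t))) '' 𝒬 t ω)) ∧
    AnalyticSet {p : Path Ω t × ProbabilityMeasure (Ω t) | p.2 ∈ 𝒬 t p.1}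

end Models

/-! ### Prices, strategies and absence of arbitrage -/

section Market

variable {Ω : ℕ → Type u} {d : ℕ}

/-- The price increment from `t` to `t + 1`, as a function of the path up to `t` and of the
outcome of the following period. -/
noncomputable def increment (S : ∀ t, Path Ω t → EuclideanSpace ℝ (Fin d)) (t : ℕ)
    (ω : Path Ω t) (w : Ω t) : EuclideanSpace ℝ (Fin d) :=
  S (t + 1) (ω.snoc w) - S t ω

/-- The value at time `t` of the self-financing portfolio with initial capital `x` and holdings
`φ s` on the period from `s` to `s + 1`, that is, `x + ∑_{s < t} ⟪φ s, S (s + 1) - S s⟫`. -/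
noncomputable def portfolioValue (S : ∀ t, Path Ω t → EuclideanSpace ℝ (Fin d)) (x : ℝ)
    (φ : ∀ t, Path Ω t → EuclideanSpace ℝ (Fin d)) : ∀ t, Path Ω t → ℝ
  | 0, _ => x
  | t + 1, (ω, w) => portfolioValue S x φ t ω + ⟪φ t ω, increment S t ω w⟫

variable [∀ n, MeasurableSpace (Ω n)]

/-- Universally predictable strategies on the time horizon `T`: the holdings `φ t` on the period
from `t` to `t + 1` are a universally measurable function of the path up to `t`. -/
def IsStrategy (T : ℕ) (φ : ∀ t, Path Ω t → EuclideanSpace ℝ (Fin d)) : Prop :=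
  ∀ t < T, Measurable[univSigma (Path Ω t)] (φ t)

/-- The multi-period no-arbitrage condition. -/
def NoArbitrage (T : ℕ) (𝒬 : ∀ t, Path Ω t → Set (ProbabilityMeasure (Ω t)))
    (S : ∀ t, Path Ω t → EuclideanSpace ℝ (Fin d)) : Prop :=
  ∀ φ : ∀ t, Path Ω t → EuclideanSpace ℝ (Fin d), IsStrategy T φ →
    QuasiSurely (models 𝒬 T) (fun ω => 0 ≤ portfolioValue S 0 φ T ω) →
    QuasiSurely (models 𝒬 T) (fun ω => portfolioValue S 0 φ T ω = 0)

/-- The one-period no-arbitrage condition at time `t` given the path `ω`. -/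
def NoArbitrageAt (𝒬 : ∀ t, Path Ω t → Set (ProbabilityMeasure (Ω t)))
    (S : ∀ t, Path Ω t → EuclideanSpace ℝ (Fin d)) (t : ℕ) (ω : Path Ω t) : Prop :=
  ∀ h : EuclideanSpace ℝ (Fin d),
    QuasiSurely (𝒬 t ω) (fun w => 0 ≤ ⟪h, increment S t ω w⟫) →
    QuasiSurely (𝒬 t ω) (fun w => ⟪h, increment S t ω w⟫ = 0)

/-- The affine hull of the quasi-sure support of the price increment from `t` to `t + 1` given
the path `ω`: the support is the intersection of all closed sets that carry the increment under
every model in `𝒬 t ω`. -/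
noncomputable def supportHull (𝒬 : ∀ t, Path Ω t → Set (ProbabilityMeasure (Ω t)))
    (S : ∀ t, Path Ω t → EuclideanSpace ℝ (Fin d)) (t : ℕ) (ω : Path Ω t) :
    AffineSubspace ℝ (EuclideanSpace ℝ (Fin d)) :=
  affineSpan ℝ (⋂₀ {A | IsClosed A ∧
    ∀ P ∈ 𝒬 t ω, (P : Measure (Ω t)) {w | increment S t ω w ∈ A} = 1})

end Market

end RobustMarket

/-!
The idea is to treat the one-period market at a fixed path by convexity and compactness, and to show
that the paths at which it admits arbitrage form a universally measurable polar set.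

At a fixed path, let `gainCone` be the cone of holdings whose gain is quasi-surely non-negative.
Absence of arbitrage says that this cone is symmetric. Then the affine hull of the support contains
the origin (`zero_mem_affineSpan_support`), since otherwise its point closest to the origin would be
a holding with a constant positive gain; and a uniform `α` exists (`exists_uniform_loss`), since
otherwise a limit of unit holdings that lose ever less would be a unit vector of the hull orthogonal
to the support.

For the dependence on the path, the complement of the cone is a union of fixed open sets, countably
many, each present on an analytic set of paths (`compl_gainCone`). Analytic sets are universally
measurable (`measurableSet_univSigma_of_analyticSet`), so the metric projections of the points of a
dense sequence on the cone are universally measurable functions of the path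
(`exists_measurable_projection`). They are dense in the cone, so the cone is symmetric once it
contains their opposites (`exists_gainCone_sequence`). This describes the arbitrage-free paths by
countably many conditions, and it suffices that each holds outside a polar set
(`isPolar_neg_notMem_gainCone`). If one failed under some model, that projection, restricted to a
suitable Borel set of paths and followed by a measurable selection of models under which it wins
(`exists_univKernel_pos`), would be an arbitrage on the horizon `t + 1`, while absence of arbitrage
passes to shorter horizons (`NoArbitrage.of_le`).

The space of probability measures enters only through a continuous parametrization of the graph of
the models by Baire space, so that neither its metrizability nor its completeness plays a role.
-/

namespace RobustMarket

open Filter Topology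

/-! ### Universal measurability of analytic sets -/

section Analytic

variable {X : Type*} [TopologicalSpace X]

/-- A continuous map on Baire space maps some compact box onto a set of almost the same outer
measure as its range. The box is found coordinate by coordinate, by continuity from below of the
outer measure; no measure is lost in the limit because every open set containing the image of the
box contains the image of one of its finite stages. -/
theorem exists_isCompact_lt_measure_image [MeasurableSpace X] [T2Space X]
    {μ : Measure X} [μ.OuterRegular] {f : (ℕ → ℕ) → X} (hf : Continuous f) {c : ℝ≥0∞}
    (hc : c < μ (range f)) : ∃ K : Set (ℕ → ℕ), IsCompact K ∧ c ≤ μ (f '' K) := by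
  have step : ∀ (k : ℕ) (C : {C : Set (ℕ → ℕ) // c < μ (f '' C)}),
      ∃ n : ℕ, c < μ (f '' (C.1 ∩ {σ | σ k ≤ n})) := by
    rintro k ⟨C, hC⟩
    have hU : f '' C = ⋃ n : ℕ, f '' (C ∩ {σ | σ k ≤ n}) := by
      rw [← image_iUnion, ← inter_iUnion]
      congr 1
      ext σ
      simp only [mem_inter_iff, mem_iUnion, mem_ofPred_eq]
      exact ⟨fun h => ⟨h, σ k, le_rfl⟩, fun h => h.1⟩
    have hmono : Monotone fun n : ℕ => f '' (C ∩ {σ | σ k ≤ n}) := fun m n hmn =>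
      image_mono (inter_subset_inter_right _ fun σ (hσ : σ k ≤ m) => hσ.trans hmn)
    rw [hU, hmono.measure_iUnion] at hC
    exact lt_iSup_iff.1 hC
  choose next hnext using step
  let C : ℕ → {C : Set (ℕ → ℕ) // c < μ (f '' C)} := fun k =>
    Nat.rec ⟨univ, by rwa [image_univ]⟩ (fun k C => ⟨C.1 ∩ {σ | σ k ≤ next k C}, hnext k C⟩) k
  let a : ℕ → ℕ := fun k => next k (C k)
  have hC : ∀ k, (C k).1 = {σ | ∀ i < k, σ i ≤ a i} := by
    intro k
    induction k with
    | zero => simp [C]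
    | succ k ih =>
      change (C k).1 ∩ {σ | σ k ≤ a k} = _
      rw [ih]
      ext σ
      simp only [mem_inter_iff, mem_ofPred_eq, Nat.lt_succ_iff_lt_or_eq]
      exact ⟨fun h i hi => hi.elim (h.1 i) fun e => e ▸ h.2,
        fun h => ⟨fun i hi => h i (Or.inl hi), h k (Or.inr rfl)⟩⟩
  let K : Set (ℕ → ℕ) := {σ | ∀ i, σ i ∈ Iic (a i)}
  have hK : IsCompact K := isCompact_pi_infinite fun i => (finite_Iic (a i)).isCompact
  refine ⟨K, hK, ?_⟩
  rw [(f '' K).measure_eq_iInf_isOpen]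
  refine le_iInf fun U => le_iInf fun hKU => le_iInf fun hU => ?_
  obtain ⟨k, hk⟩ : ∃ k, (C k).1 ⊆ f ⁻¹' U := by
    by_contra! hno
    have hno' : ∀ k, ∃ σ, σ ∈ (C k).1 ∧ σ ∉ f ⁻¹' U := fun k => not_subset.1 (hno k)
    choose σ hσC hσU using hno'
    -- Truncating `σ k` to the box changes only the coordinates from `k` on, so both sequences have
    -- the same limits.
    obtain ⟨τ, hτ, φ, hφ, hlim⟩ := hK.tendsto_subseq
      (x := fun k i => min (σ k i) (a i)) fun k i => mem_Iic.2 (min_le_right _ _)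
    have hlim' : Tendsto (fun k => σ (φ k)) atTop (𝓝 τ) := by
      rw [tendsto_pi_nhds] at hlim ⊢
      intro i
      refine (hlim i).congr' ?_
      filter_upwards [eventually_gt_atTop i] with k hk
      have h1 := hσC (φ k)
      rw [hC] at h1
      exact min_eq_left (h1 i (hk.trans_le (hφ.id_le k)))
    have hτU : τ ∈ f ⁻¹' U := hKU (mem_image_of_mem f hτ)
    obtain ⟨k, hk⟩ := (hlim'.eventually ((hU.preimage hf).mem_nhds hτU)).exists
    exact hσU _ hk
  exact (C k).2.le.trans (measure_mono (image_subset_iff.2 hk))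

theorem nullMeasurableSet_of_analyticSet [MeasurableSpace X] [T2Space X] [OpensMeasurableSpace X]
    (μ : Measure X) [IsFiniteMeasure μ] [μ.OuterRegular] {A : Set X} (hA : AnalyticSet A) :
    NullMeasurableSet A μ := by
  rw [AnalyticSet] at hA
  rcases hA with rfl | ⟨f, hf, rfl⟩
  · exact nullMeasurableSet_empty
  rcases eq_or_ne (μ (range f)) 0 with h0 | h0
  · exact .of_null h0
  obtain ⟨c, -, hc, hlim⟩ := exists_seq_strictMono_tendsto' (pos_iff_ne_zero.2 h0)
  choose K hK hcK using fun n => exists_isCompact_lt_measure_image hf (hc n).2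
  have hM : MeasurableSet (⋃ n, f '' K n) :=
    .iUnion fun n => ((hK n).image hf).isClosed.measurableSet
  refine hM.nullMeasurableSet.congr (ae_eq_of_subset_of_measure_ge
    (iUnion_subset fun n => image_subset_range _ _) ?_ hM.nullMeasurableSet (measure_ne_top _ _))
  exact le_of_tendsto' hlim fun n =>
    (hcK n).trans (measure_mono (subset_iUnion (fun n => f '' K n) n))

theorem measurableSet_univSigma_of_analyticSet [PolishSpace X] [MeasurableSpace X] [BorelSpace X]
    {A : Set X} (hA : AnalyticSet A) : MeasurableSet[univSigma X] A :=
  fun P => nullMeasurableSet_of_analyticSet (P : Measure X) hA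

/-! ### Measurable selection -/

/-- The lexicographically least point in the fibre of `f` over `x`, built coordinate by coordinate:
the `k`-th coordinate is the least one that some point of the fibre extending the coordinates
chosen so far has. The infimum is over the empty set when `x` is not in the range of `f`. -/
noncomputable def leftmost (f : (ℕ → ℕ) → X) (x : X) (k : ℕ) : ℕ :=
  sInf {n | ∃ σ, f σ = x ∧ (∀ i : Fin k, σ i = leftmost f x i) ∧ σ k = n}
termination_by k
decreasing_by exact i.2

theorem apply_leftmost [T2Space X] {f : (ℕ → ℕ) → X} (hf : Continuous f) {x : X}
    (hx : x ∈ range f) : f (leftmost f x) = x := by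
  have key : ∀ k, ∃ σ, f σ = x ∧ ∀ i < k, σ i = leftmost f x i := by
    intro k
    induction k with
    | zero => exact hx.imp fun σ hσ => ⟨hσ, by simp⟩
    | succ k ih =>
      obtain ⟨σ, hσ, hi⟩ := ih
      have hmem : leftmost f x k ∈
          {n | ∃ σ, f σ = x ∧ (∀ i : Fin k, σ i = leftmost f x i) ∧ σ k = n} := by
        rw [leftmost]
        exact Nat.sInf_mem ⟨σ k, σ, hσ, fun i => hi i i.2, rfl⟩
      obtain ⟨τ, hτ, hτi, hτk⟩ := hmem
      refine ⟨τ, hτ, fun i hi => ?_⟩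
      rcases Nat.lt_succ_iff_lt_or_eq.1 hi with h | rfl
      · exact hτi ⟨i, h⟩
      · exact hτk
  choose σ hσ hi using key
  have hlim : Tendsto σ atTop (𝓝 (leftmost f x)) := by
    rw [tendsto_pi_nhds]
    intro i
    refine tendsto_const_nhds.congr' ?_
    filter_upwards [eventually_gt_atTop i] with k hk
    exact (hi k i hk).symm
  refine tendsto_nhds_unique ((hf.tendsto _).comp hlim) ?_
  exact tendsto_const_nhds.congr fun k => (hσ k).symm

/-- The leftmost selection is universally measurable: given the coordinates chosen so far, which
range over a countable set, the next one is determined by the membership of `x` in countably many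
analytic sets. -/
theorem measurable_leftmost [PolishSpace X] [MeasurableSpace X] [BorelSpace X]
    {f : (ℕ → ℕ) → X} (hf : Continuous f) : Measurable[univSigma X] (leftmost f) := by
  have hS : ∀ (k : ℕ) (p : Fin k → ℕ) (n : ℕ), MeasurableSet[univSigma X]
      (f '' {σ | (∀ i : Fin k, σ i = p i) ∧ σ k = n}) := by
    intro k p n
    refine measurableSet_univSigma_of_analyticSet ?_
    refine AnalyticSet.image_of_continuous (IsClosed.analyticSet ?_) hf
    refine IsClosed.and ?_ (isClosed_eq (continuous_apply k) continuous_const)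
    rw [ofPred_forall]
    exact isClosed_iInter fun i => isClosed_eq (continuous_apply _) continuous_const
  let _ : MeasurableSpace X := univSigma X
  refine measurable_pi_iff.2 fun k => ?_
  induction k using Nat.strong_induction_on with
  | _ k ih =>
    let S : (Fin k → ℕ) → ℕ → Set X :=
      fun p n => f '' {σ | (∀ i : Fin k, σ i = p i) ∧ σ k = n}
    replace hS : ∀ p n, MeasurableSet (S p n) := hS k
    have hT : ∀ p, Measurable fun x => sInf {n | x ∈ S p n} := by
      intro p
      refine measurable_to_countable' fun m => ?_
      have : (fun x => sInf {n | x ∈ S p n}) ⁻¹' {m} =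
          (S p m ∩ ⋂ j, ⋂ (_ : j < m), (S p j)ᶜ) ∪ {x | m = 0 ∧ ∀ j, x ∉ S p j} := by
        ext x
        simp only [mem_preimage, mem_singleton_iff, mem_union, mem_inter_iff, mem_iInter,
          mem_compl_iff, mem_ofPred_eq]
        constructor
        · rintro rfl
          by_cases hne : {n | x ∈ S p n}.Nonempty
          · exact Or.inl ⟨Nat.sInf_mem hne, fun j hj => Nat.notMem_of_lt_sInf hj⟩
          · refine Or.inr ⟨?_, fun j hj => hne ⟨j, hj⟩⟩
            rw [not_nonempty_iff_eq_empty.1 hne, Nat.sInf_empty]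
        · rintro (⟨h1, h2⟩ | ⟨rfl, h⟩)
          · refine le_antisymm (Nat.sInf_le h1) ?_
            exact le_csInf ⟨m, h1⟩ fun j hj => not_lt.1 fun hjm => h2 j hjm hj
          · rw [eq_empty_of_forall_notMem (s := {n | x ∈ S p n}) h, Nat.sInf_empty]
      rw [this]
      refine ((hS p m).inter (.iInter fun j => .iInter fun _ => (hS p j).compl)).union ?_
      rw [ofPred_and, ofPred_forall]
      exact (MeasurableSet.const _).inter (.iInter fun j => (hS p j).compl)
    have hprod : Measurable fun z : X × (Fin k → ℕ) => sInf {n | z.1 ∈ S z.2 n} :=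
      measurable_from_prod_countable_left hT
    have hr : Measurable fun x => (x, fun i : Fin k => leftmost f x i) :=
      measurable_id.prodMk (measurable_pi_iff.2 fun i => ih i i.2)
    convert hprod.comp hr using 1
    funext x
    rw [leftmost]
    simp only [S, Function.comp_apply, mem_image, mem_ofPred_eq]
    congr 1
    ext n
    simp only [mem_ofPred_eq]
    exact exists_congr fun σ => and_comm

end Analytic

/-! ### Analytic families of models -/

/-- The weak topology refines the σ-algebra of evaluations: on open sets evaluation is lower
semicontinuous, by the portmanteau theorem. -/
theorem measurable_of_continuous_probabilityMeasure {Z Y : Type*} [TopologicalSpace Z]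
    [MeasurableSpace Z] [OpensMeasurableSpace Z] [TopologicalSpace Y] [PolishSpace Y]
    [MeasurableSpace Y] [BorelSpace Y] {g : Z → ProbabilityMeasure Y} (hg : Continuous g) :
    Measurable g := by
  refine Measurable.subtype_mk (f := fun z => (g z : Measure Y)) ?_
  refine Measurable.measure_of_isPiSystem (BorelSpace.measurable_eq (α := Y)) isPiSystem_isOpen
    (fun G hG => ?_) (by simp)
  refine LowerSemicontinuous.measurable fun z => ?_
  refine lowerSemicontinuousAt_iff_le_liminf.2 ?_
  exact ProbabilityMeasure.le_liminf_measure_open_of_tendsto (hg.tendsto z) hG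

section Selection

variable {X : Type u} {Y : Type v} [TopologicalSpace X] [MeasurableSpace X]
  [BorelSpace X] [TopologicalSpace Y] [PolishSpace Y] [MeasurableSpace Y] [BorelSpace Y]
  {𝒬 : X → Set (ProbabilityMeasure Y)}

/-- The pairs `(x, P)` with `P ∈ 𝒬 x` that charge the section over `x` of a Borel set are
parametrized by Baire space, continuously in `x` and measurably in `P`, unless there are none. -/
theorem exists_parametrization
    (h𝒬 : AnalyticSet {p : X × ProbabilityMeasure Y | p.2 ∈ 𝒬 p.1})
    {E : Set (X × Y)} (hE : MeasurableSet E)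
    (hne : ∃ x, ∃ P ∈ 𝒬 x, 0 < (P : Measure Y) {y | (x, y) ∈ E}) :
    ∃ (g : (ℕ → ℕ) → X) (p : (ℕ → ℕ) → ProbabilityMeasure Y), Continuous g ∧ Measurable p ∧
      (∀ σ, p σ ∈ 𝒬 (g σ) ∧ 0 < (p σ : Measure Y) {y | (g σ, y) ∈ E}) ∧
      ∀ x, x ∈ range g ↔ ∃ P ∈ 𝒬 x, 0 < (P : Measure Y) {y | (x, y) ∈ E} := by
  rw [AnalyticSet] at h𝒬
  rcases h𝒬 with h0 | ⟨f, hf, hrange⟩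
  · obtain ⟨x, P, hP, -⟩ := hne
    exact absurd (show (x, P) ∈ {p : X × ProbabilityMeasure Y | p.2 ∈ 𝒬 p.1} from hP)
      (by simp [h0])
  have hmem : ∀ σ, (f σ).2 ∈ 𝒬 (f σ).1 := fun σ => hrange.le (mem_range_self σ)
  have hp : Measurable fun σ => (f σ).2 :=
    measurable_of_continuous_probabilityMeasure (continuous_snd.comp hf)
  let κ : ProbabilityTheory.Kernel (ℕ → ℕ) Y :=
    ⟨fun σ => ((f σ).2 : Measure Y), measurable_subtype_coe.comp hp⟩
  have hκ : ProbabilityTheory.IsMarkovKernel κ :=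
    ⟨fun σ => inferInstanceAs (IsProbabilityMeasure ((f σ).2 : Measure Y))⟩
  have hpre : MeasurableSet ((fun z : (ℕ → ℕ) × Y => ((f z.1).1, z.2)) ⁻¹' E) :=
    (((continuous_fst.comp hf).measurable.comp measurable_fst).prodMk measurable_snd) hE
  let Z : Set (ℕ → ℕ) := {σ | 0 < ((f σ).2 : Measure Y) {y | ((f σ).1, y) ∈ E}}
  have hZ : MeasurableSet Z :=
    measurableSet_lt measurable_const (ProbabilityTheory.Kernel.measurable_kernel_prodMk_left
      (κ := κ) hpre)
  have hiff : ∀ x, (∃ P ∈ 𝒬 x, 0 < (P : Measure Y) {y | (x, y) ∈ E}) ↔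
      ∃ σ ∈ Z, (f σ).1 = x := by
    intro x
    constructor
    · rintro ⟨P, hP, hpos⟩
      obtain ⟨σ, hσ⟩ : (x, P) ∈ range f := hrange.ge hP
      refine ⟨σ, ?_, by rw [hσ]⟩
      change 0 < ((f σ).2 : Measure Y) {y | ((f σ).1, y) ∈ E}
      rwa [hσ]
    · rintro ⟨σ, hσ, rfl⟩
      exact ⟨_, hmem σ, hσ⟩
  have hZan : AnalyticSet Z := hZ.analyticSet
  rw [AnalyticSet] at hZan
  rcases hZan with h0 | ⟨c, hc, hcZ⟩
  · obtain ⟨x, hx⟩ := hne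
    obtain ⟨σ, hσ, -⟩ := (hiff x).1 hx
    simp [h0] at hσ
  · refine ⟨fun σ => (f (c σ)).1, fun σ => (f (c σ)).2, continuous_fst.comp (hf.comp hc),
      hp.comp hc.measurable, fun σ => ⟨hmem _, hcZ.le (mem_range_self σ)⟩, fun x => ?_⟩
    rw [hiff, ← hcZ, exists_range_iff]
    rfl

variable [PolishSpace X]

/-- The points at which some model charges the section of a Borel set form a universally
measurable set. -/
theorem measurableSet_exists_pos
    (h𝒬 : AnalyticSet {p : X × ProbabilityMeasure Y | p.2 ∈ 𝒬 p.1})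
    {E : Set (X × Y)} (hE : MeasurableSet E) :
    MeasurableSet[univSigma X] {x | ∃ P ∈ 𝒬 x, 0 < (P : Measure Y) {y | (x, y) ∈ E}} := by
  by_cases hne : ∃ x, ∃ P ∈ 𝒬 x, 0 < (P : Measure Y) {y | (x, y) ∈ E}
  · obtain ⟨g, p, hg, -, -, hr⟩ := exists_parametrization h𝒬 hE hne
    have : {x | ∃ P ∈ 𝒬 x, 0 < (P : Measure Y) {y | (x, y) ∈ E}} = range g :=
      Set.ext fun x => (hr x).symm
    rw [this]
    exact measurableSet_univSigma_of_analyticSet (analyticSet_range_of_polishSpace hg)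
  · have : {x | ∃ P ∈ 𝒬 x, 0 < (P : Measure Y) {y | (x, y) ∈ E}} = ∅ :=
      eq_empty_of_forall_notMem fun x hx => hne ⟨x, hx⟩
    rw [this]
    exact @MeasurableSet.empty X (univSigma X)

/-- A universally measurable kernel can be chosen among the models that charge the section of a
Borel set, wherever there are any. -/
theorem exists_univKernel_pos
    (h𝒬 : AnalyticSet {p : X × ProbabilityMeasure Y | p.2 ∈ 𝒬 p.1})
    {E : Set (X × Y)} (hE : MeasurableSet E)
    (hne : ∃ x, ∃ P ∈ 𝒬 x, 0 < (P : Measure Y) {y | (x, y) ∈ E}) :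
    ∃ q : UnivKernel X Y, ∀ x, (∃ P ∈ 𝒬 x, 0 < (P : Measure Y) {y | (x, y) ∈ E}) →
      q.toFun x ∈ 𝒬 x ∧ 0 < (q.toFun x : Measure Y) {y | (x, y) ∈ E} := by
  obtain ⟨g, p, hg, hp, hgp, hr⟩ := exists_parametrization h𝒬 hE hne
  refine ⟨⟨fun x => p (leftmost g x), hp.comp (measurable_leftmost hg)⟩, fun x hx => ?_⟩
  have := hgp (leftmost g x)
  rwa [apply_leftmost hg ((hr x).2 hx)] at this

theorem exists_univKernel_mem [Nonempty X]
    (h𝒬 : AnalyticSet {p : X × ProbabilityMeasure Y | p.2 ∈ 𝒬 p.1})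
    (hne : ∀ x, (𝒬 x).Nonempty) : ∃ q : UnivKernel X Y, ∀ x, q.toFun x ∈ 𝒬 x := by
  have hpos : ∀ x, ∃ P ∈ 𝒬 x, 0 < (P : Measure Y) {y | (x, y) ∈ (univ : Set (X × Y))} :=
    fun x => (hne x).imp fun P hP => ⟨hP, by simp⟩
  obtain ⟨q, hq⟩ := exists_univKernel_pos h𝒬 .univ ⟨Classical.arbitrary X, hpos _⟩
  exact ⟨q, fun x => (hq x (hpos x)).1⟩

end Selection

/-! ### Measurability of the metric projection -/

section Projection

variable {X ι : Type*} [MeasurableSpace X] {H : Type*}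
  {A : ι → Set X} {V : ι → Set H} {K : X → Set H}

theorem measurableSet_inter_nonempty [Countable ι] [TopologicalSpace H]
    (hA : ∀ i, MeasurableSet (A i)) (hV : ∀ i, IsOpen (V i))
    (hK : ∀ x, (K x)ᶜ = ⋃ i, ⋃ (_ : x ∈ A i), V i) {C : Set H} (hC : IsCompact C) :
    MeasurableSet {x | (K x ∩ C).Nonempty} := by
  have : {x | (K x ∩ C).Nonempty} =
      (⋃ s : Finset ι, ⋃ (_ : C ⊆ ⋃ i ∈ s, V i), ⋂ i ∈ s, A i)ᶜ := by
    ext x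
    simp only [mem_ofPred_eq, mem_compl_iff, mem_iUnion, mem_iInter, not_exists, exists_prop]
    rw [← not_iff_not, not_nonempty_iff_eq_empty, ← disjoint_iff_inter_eq_empty,
      ← subset_compl_iff_disjoint_left, hK]
    push Not
    constructor
    · intro h
      have h' : C ⊆ ⋃ i : {i // x ∈ A i}, V i := h.trans (by rw [iUnion_subtype])
      obtain ⟨s, hs⟩ := hC.elim_finite_subcover _ (fun i : {i // x ∈ A i} => hV i) h'
      refine ⟨s.map (Function.Embedding.subtype _), ?_, ?_⟩
      · refine hs.trans fun h hh => ?_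
        simp only [mem_iUnion] at hh ⊢
        obtain ⟨i, hi, hh⟩ := hh
        exact ⟨i, by simpa using ⟨i.2, hi⟩, hh⟩
      · simp only [Finset.mem_map]
        rintro i ⟨j, -, rfl⟩
        exact j.2
    · rintro ⟨s, hs, hx⟩
      refine hs.trans fun h hh => ?_
      simp only [mem_iUnion] at hh ⊢
      obtain ⟨i, hi, hh⟩ := hh
      exact ⟨i, hx i hi, hh⟩
  rw [this]
  exact (MeasurableSet.iUnion fun s => .iUnion fun _ =>
    Finset.measurableSet_biInter s fun i _ => hA i).compl

variable [Countable ι] [NormedAddCommGroup H] [InnerProductSpace ℝ H] [ProperSpace H]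
  [MeasurableSpace H] [BorelSpace H]

/-- The metric projection of a point on a closed convex set depends measurably on the set: the
projection lies in a closed set `F` exactly when the part of the convex set in `F` meets every ball
of rational radius that the convex set meets. -/
theorem exists_measurable_projection
    (hA : ∀ i, MeasurableSet (A i)) (hV : ∀ i, IsOpen (V i))
    (hK : ∀ x, (K x)ᶜ = ⋃ i, ⋃ (_ : x ∈ A i), V i) (hconv : ∀ x, Convex ℝ (K x))
    (hne : ∀ x, (K x).Nonempty) (c : H) :
    ∃ p : X → H, Measurable p ∧ ∀ x, p x ∈ K x ∧ ∀ k ∈ K x, dist (p x) c ≤ dist k c := by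
  have hclosed : ∀ x, IsClosed (K x) := fun x => by
    rw [← isOpen_compl_iff, hK]
    exact isOpen_iUnion fun i => isOpen_iUnion fun _ => hV i
  have hproj : ∀ x, ∃ p ∈ K x, (∀ k ∈ K x, dist p c ≤ dist k c) ∧
      ∀ k ∈ K x, dist k c ≤ dist p c → k = p := by
    intro x
    obtain ⟨p, hp, hmin⟩ := (hclosed x).exists_infDist_eq_dist (hne x) c
    have hle : ∀ k ∈ K x, dist p c ≤ dist k c := fun k hk => by
      rw [dist_comm p, ← hmin, dist_comm k]
      exact Metric.infDist_le_dist_of_mem hk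
    refine ⟨p, hp, hle, fun k hk hkc => ?_⟩
    -- The midpoint of two distinct closest points would be closer, by the parallelogram law.
    have hmid := hle _ ((hconv x).midpoint_mem hp hk)
    have hpk : dist k c = dist p c := le_antisymm hkc (hle k hk)
    have hpar := parallelogram_law_with_norm ℝ (p - c) (k - c)
    have hm : midpoint ℝ p k - c = (2⁻¹ : ℝ) • ((p - c) + (k - c)) := by
      rw [midpoint_eq_smul_add, invOf_eq_inv]
      module
    rw [dist_eq_norm, dist_eq_norm, hm, norm_smul] at hmid
    rw [dist_eq_norm, dist_eq_norm] at hpk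
    rw [sub_sub_sub_cancel_right, hpk] at hpar
    norm_num at hmid
    have h0 : ‖p - k‖ = 0 := by
      nlinarith [norm_nonneg (p - c), norm_nonneg (p - k), norm_nonneg (p - c + (k - c))]
    exact (sub_eq_zero.1 (norm_eq_zero.1 h0)).symm
  choose p hpK hle huniq using hproj
  refine ⟨p, measurable_of_isClosed fun F hF => ?_, fun x => ⟨hpK x, hle x⟩⟩
  have : p ⁻¹' F = ⋂ r : ℚ, ({x | (K x ∩ Metric.closedBall c r).Nonempty}ᶜ ∪
      {x | (K x ∩ (F ∩ Metric.closedBall c r)).Nonempty}) := by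
    ext x
    simp only [mem_preimage, mem_iInter, mem_union, mem_compl_iff, mem_ofPred_eq]
    simp only [← imp_iff_not_or]
    constructor
    · rintro hpF r ⟨k, hk, hkr⟩
      exact ⟨p x, hpK x, hpF, (hle x k hk).trans hkr⟩
    · intro h
      obtain ⟨r, -, hr, hlim⟩ := Real.exists_seq_rat_strictAnti_tendsto (dist (p x) c)
      have hk : ∀ n, ∃ k ∈ K x, k ∈ F ∧ dist k c ≤ r n := by
        intro n
        obtain ⟨k, hk1, hk2, hk3⟩ := h (r n) ⟨p x, hpK x, (hr n).le⟩
        exact ⟨k, hk1, hk2, hk3⟩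
      choose k hkK hkF hku using hk
      obtain ⟨R, hR⟩ := hlim.bddAbove_range
      obtain ⟨k₀, -, φ, hφ, hk₀⟩ := (isCompact_closedBall c R).tendsto_subseq (x := k)
        fun n => Metric.mem_closedBall.2 ((hku n).trans (hR (mem_range_self n)))
      have h1 : k₀ ∈ K x := (hclosed x).mem_of_tendsto hk₀ (.of_forall fun n => hkK _)
      have h2 : k₀ ∈ F := hF.mem_of_tendsto hk₀ (.of_forall fun n => hkF _)
      have h3 : dist k₀ c ≤ dist (p x) c :=
        le_of_tendsto_of_tendsto' (hk₀.dist tendsto_const_nhds)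
          (hlim.comp hφ.tendsto_atTop) fun n => hku _
      rwa [← huniq x k₀ h1 h3]
  rw [this]
  refine .iInter fun r => ?_
  exact (measurableSet_inter_nonempty hA hV hK (isCompact_closedBall c r)).compl.union
    (measurableSet_inter_nonempty hA hV hK ((isCompact_closedBall c r).inter_left hF))

end Projection

/-! ### The one-period market -/

section OnePeriod

/-- The quasi-sure support has full measure under every model, because an intersection of closed
sets is an intersection of countably many of them. -/
theorem measure_support_eq_one {Y : Type v} [MeasurableSpace Y] {H : Type*} [TopologicalSpace H]
    [SecondCountableTopology H] [MeasurableSpace H] [BorelSpace H] {𝓜 : Set (ProbabilityMeasure Y)}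
    {Z : Y → H} (hZ : Measurable Z) {P : ProbabilityMeasure Y} (hP : P ∈ 𝓜) :
    (P : Measure Y) {y | Z y ∈ ⋂₀ {A | IsClosed A ∧
      ∀ P ∈ 𝓜, (P : Measure Y) {y | Z y ∈ A} = 1}} = 1 := by
  set 𝓐 := {A : Set H | IsClosed A ∧ ∀ P ∈ 𝓜, (P : Measure Y) {y | Z y ∈ A} = 1}
  obtain ⟨T, hTc, hT, hU⟩ := TopologicalSpace.isOpen_sUnion_countable (compl '' 𝓐) (by
    rintro _ ⟨A, hA, rfl⟩
    exact hA.1.isOpen_compl)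
  have hS : (⋂₀ 𝓐)ᶜ = ⋃₀ T := by rw [compl_sInter, hU]
  have hclosed : IsClosed (⋂₀ 𝓐) := isClosed_sInter fun A hA => hA.1
  have hm : MeasurableSet {y | Z y ∈ ⋂₀ 𝓐} := hZ hclosed.measurableSet
  rw [← prob_compl_eq_zero_iff hm]
  have : {y | Z y ∈ ⋂₀ 𝓐}ᶜ = ⋃ B ∈ T, Z ⁻¹' B := by
    change Z ⁻¹' (⋂₀ 𝓐)ᶜ = _
    rw [hS, sUnion_eq_biUnion, preimage_iUnion₂]
  rw [this, measure_biUnion_null_iff hTc]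
  intro B hB
  obtain ⟨A, hA, rfl⟩ := hT hB
  rw [preimage_compl, prob_compl_eq_zero_iff (hZ hA.1.measurableSet)]
  exact hA.2 P hP

variable {Y : Type v} [MeasurableSpace Y] {H : Type*} [NormedAddCommGroup H]
  [InnerProductSpace ℝ H]

/-- The cone of the holdings `h` whose gain `⟪h, Z⟫` is quasi-surely non-negative. Absence of
arbitrage says that this cone is symmetric. -/
def gainCone (𝓜 : Set (ProbabilityMeasure Y)) (Z : Y → H) : Set H :=
  {h | QuasiSurely 𝓜 fun y => 0 ≤ ⟪h, Z y⟫}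

variable {𝓜 : Set (ProbabilityMeasure Y)} {Z : Y → H}

theorem mem_gainCone {h : H} :
    h ∈ gainCone 𝓜 Z ↔ ∀ P ∈ 𝓜, (P : Measure Y) {y | ⟪h, Z y⟫ < 0} = 0 := by
  simp [gainCone, QuasiSurely, IsPolar]

theorem convex_gainCone : Convex ℝ (gainCone 𝓜 Z) := by
  intro h hh k hk a b ha hb _
  rw [mem_gainCone] at *
  intro P hP
  refine measure_mono_null (fun y hy => ?_) (measure_union_null (hh P hP) (hk P hP))
  by_contra hno
  simp only [mem_union, mem_ofPred_eq, not_or, not_lt] at hno hy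
  rw [inner_add_left, inner_smul_left, inner_smul_left] at hy
  exact absurd hy (not_lt.2 (add_nonneg (mul_nonneg ha hno.1) (mul_nonneg hb hno.2)))

theorem zero_mem_gainCone : (0 : H) ∈ gainCone 𝓜 Z := by
  simp [mem_gainCone]

theorem quasiSurely_eq_zero {h : H} (h1 : h ∈ gainCone 𝓜 Z) (h2 : -h ∈ gainCone 𝓜 Z) :
    QuasiSurely 𝓜 fun y => ⟪h, Z y⟫ = 0 := by
  rw [mem_gainCone] at *
  intro P hP
  refine measure_mono_null (fun y hy => ?_) (measure_union_null (h1 P hP) (h2 P hP))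
  simpa using lt_or_gt_of_ne hy

variable [MeasurableSpace H] [BorelSpace H]

variable [FiniteDimensional ℝ H]

/-- Without arbitrage the affine hull of the support contains the origin: the point of the hull
closest to the origin is a holding with a constant gain, the square of its norm. -/
theorem zero_mem_affineSpan_support (hZ : Measurable Z) (hne : 𝓜.Nonempty)
    (hNA : ∀ h ∈ gainCone 𝓜 Z, QuasiSurely 𝓜 fun y => ⟪h, Z y⟫ = 0) :
    (0 : H) ∈ affineSpan ℝ (⋂₀ {A : Set H | IsClosed A ∧
      ∀ P ∈ 𝓜, (P : Measure Y) {y | Z y ∈ A} = 1}) := by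
  have hfull := fun P hP => measure_support_eq_one (𝓜 := 𝓜) hZ (P := P) hP
  set S := ⋂₀ {A : Set H | IsClosed A ∧ ∀ P ∈ 𝓜, (P : Measure Y) {y | Z y ∈ A} = 1}
  have hae : ∀ P ∈ 𝓜, ∀ᵐ y ∂(P : Measure Y), Z y ∈ S := fun P hP =>
    (mem_ae_iff_prob_eq_one (hZ (isClosed_sInter fun A hA => hA.1).measurableSet)).2 (hfull P hP)
  obtain ⟨P, hP⟩ := hne
  obtain ⟨y₀, hy₀⟩ := (hae P hP).exists
  have hy₀' := subset_affineSpan ℝ S hy₀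
  let W := (affineSpan ℝ S).direction
  let v : H := Z y₀ - W.starProjection (Z y₀)
  have hv : v ∈ affineSpan ℝ S := by
    have := AffineSubspace.vadd_mem_of_mem_direction
      (W.neg_mem (W.starProjection_apply_mem (Z y₀))) hy₀'
    rwa [vadd_eq_add, neg_add_eq_sub] at this
  have hgain : ∀ x ∈ S, ⟪v, x⟫ = ‖v‖ ^ 2 := by
    intro x hx
    have h1 : x - v ∈ W :=
      AffineSubspace.vsub_mem_direction (subset_affineSpan ℝ S hx) hv
    have h2 := W.inner_left_of_mem_orthogonal h1 (W.sub_starProjection_mem_orthogonal (Z y₀))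
    rwa [inner_sub_right, sub_eq_zero, real_inner_self_eq_norm_sq] at h2
  have hcone : v ∈ gainCone 𝓜 Z := by
    rw [mem_gainCone]
    intro P hP
    refine measure_mono_null (fun y hy => ?_) (mem_ae_iff.1 (hae P hP))
    intro hyS
    rw [mem_ofPred_eq, hgain _ hyS] at hy
    exact absurd hy (not_lt.2 (sq_nonneg _))
  have hzero : ∀ᵐ y ∂(P : Measure Y), ⟪v, Z y⟫ = 0 := hNA v hcone P hP
  obtain ⟨y, hy, hyS⟩ := (hzero.and (hae P hP)).exists
  rw [hgain _ hyS, sq_eq_zero_iff, norm_eq_zero] at hy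
  exact hy ▸ hv

/-- Quantitative absence of arbitrage: were there no uniform bound, a limit of unit holdings that
lose ever less would, by Fatou's lemma, lose nothing, hence by absence of arbitrage gain nothing,
and so be orthogonal to the hull that contains it. -/
theorem exists_uniform_loss (hZ : Measurable Z) (hne : 𝓜.Nonempty)
    (hNA : ∀ h ∈ gainCone 𝓜 Z, QuasiSurely 𝓜 fun y => ⟪h, Z y⟫ = 0) :
    ∃ α : ℝ, 0 < α ∧ ∀ h ∈ affineSpan ℝ (⋂₀ {A : Set H | IsClosed A ∧
      ∀ P ∈ 𝓜, (P : Measure Y) {y | Z y ∈ A} = 1}), h ≠ 0 →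
        ∃ P ∈ 𝓜, α < (P : Measure Y).real {y | ⟪(1 / ‖h‖) • h, Z y⟫ < -α} := by
  have h0 := zero_mem_affineSpan_support hZ hne hNA
  set S := ⋂₀ {A : Set H | IsClosed A ∧ ∀ P ∈ 𝓜, (P : Measure Y) {y | Z y ∈ A} = 1}
  let W := (affineSpan ℝ S).direction
  have hW : ∀ h, h ∈ W ↔ h ∈ affineSpan ℝ S := fun h => by
    rw [← AffineSubspace.vsub_right_mem_direction_iff_mem h0 h, vsub_eq_sub, sub_zero]
  by_contra! hno
  choose! a haD ha0 haP using hno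
  let ε : ℕ → ℝ := fun n => 1 / ((n : ℝ) + 1)
  have hε : ∀ n, 0 < ε n := fun n => Nat.one_div_pos_of_nat
  let e : ℕ → H := fun n => (1 / ‖a (ε n)‖) • a (ε n)
  have heW : ∀ n, e n ∈ W := fun n => W.smul_mem _ ((hW _).2 (haD _ (hε n)))
  have he1 : ∀ n, e n ∈ Metric.sphere (0 : H) 1 := fun n => by
    rw [mem_sphere_zero_iff_norm, norm_smul, norm_div, norm_one, norm_norm,
      one_div_mul_cancel (norm_ne_zero_iff.2 (ha0 _ (hε n)))]
  have : ProperSpace H := FiniteDimensional.proper ℝ H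
  obtain ⟨u, hu, φ, hφ, hlim⟩ := (isCompact_sphere (0 : H) 1).tendsto_subseq he1
  have huW : u ∈ W :=
    W.closed_of_finiteDimensional.mem_of_tendsto hlim (.of_forall fun n => heW _)
  have hε0 : Tendsto (fun n => ε (φ n)) atTop (𝓝 0) :=
    (tendsto_one_div_add_atTop_nhds_zero_nat (𝕜 := ℝ)).comp hφ.tendsto_atTop
  have hcone : u ∈ gainCone 𝓜 Z := by
    rw [mem_gainCone]
    intro P hP
    let B : ℕ → Set Y := fun n => {y | ⟪e (φ n), Z y⟫ < -ε (φ n)}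
    have hsub : {y | ⟪u, Z y⟫ < 0} ⊆ ⋃ n, ⋂ k, B (n + k) := by
      intro y hy
      have h1 : Tendsto (fun n => ⟪e (φ n), Z y⟫) atTop (𝓝 ⟪u, Z y⟫) :=
        hlim.inner tendsto_const_nhds
      have h2 : Tendsto (fun n => -ε (φ n)) atTop (𝓝 0) := by simpa using hε0.neg
      obtain ⟨n, hn⟩ := eventually_atTop.1 (h1.eventually_lt h2 hy)
      exact mem_iUnion.2 ⟨n, mem_iInter.2 fun k => hn (n + k) (Nat.le_add_right n k)⟩
    refine measure_mono_null hsub (measure_iUnion_null fun n => ?_)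
    have hle : ∀ k, (P : Measure Y) (⋂ k, B (n + k)) ≤ ENNReal.ofReal (ε (φ (n + k))) := by
      intro k
      refine (measure_mono (iInter_subset _ k)).trans ?_
      rw [← ofReal_measureReal]
      exact ENNReal.ofReal_le_ofReal (haP _ (hε _) P hP)
    have hlim0 : Tendsto (fun k => ENNReal.ofReal (ε (φ (n + k)))) atTop (𝓝 0) := by
      rw [← ENNReal.ofReal_zero]
      refine ENNReal.tendsto_ofReal ?_
      simpa [add_comm] using (tendsto_add_atTop_iff_nat n).2 hε0
    exact le_antisymm (ge_of_tendsto' hlim0 hle) zero_le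
  have hzero := hNA u hcone
  have hSu : S ⊆ ((ℝ ∙ u)ᗮ.toAffineSubspace : Set H) := by
    refine sInter_subset_of_mem ⟨(ℝ ∙ u)ᗮ.closed_of_finiteDimensional, fun P hP => ?_⟩
    have hcl : MeasurableSet {y | Z y ∈ ((ℝ ∙ u)ᗮ.toAffineSubspace : Set H)} :=
      hZ (ℝ ∙ u)ᗮ.closed_of_finiteDimensional.measurableSet
    rw [← mem_ae_iff_prob_eq_one hcl]
    have hz : ∀ᵐ y ∂(P : Measure Y), ⟪u, Z y⟫ = 0 := hzero P hP
    filter_upwards [hz] with y hy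
    exact Submodule.mem_orthogonal_singleton_iff_inner_right.2 hy
  have huu : u ∈ (ℝ ∙ u)ᗮ := affineSpan_le.2 hSu ((hW u).1 huW)
  rw [Submodule.mem_orthogonal_singleton_iff_inner_right, real_inner_self_eq_norm_sq,
    mem_sphere_zero_iff_norm.1 hu] at huu
  norm_num at huu

end OnePeriod

section MeasurableCone

variable {X : Type u} {Y : Type v} [MeasurableSpace Y]
  {𝒬 : X → Set (ProbabilityMeasure Y)} {H : Type*} [NormedAddCommGroup H] [InnerProductSpace ℝ H]

/-- A holding `h` lies outside the cone exactly when some basic open set `O` that is charged by the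
increment lies in `{z | ⟪h, z⟫ < 0}`, and the openness of the inner product lets `O` be chosen so
that this persists near `h`. -/
theorem compl_gainCone [SecondCountableTopology H] (F : X → Y → H) (x : X) :
    (gainCone (𝒬 x) (F x))ᶜ = ⋃ O : TopologicalSpace.countableBasis H,
      ⋃ (_ : x ∈ {x | ∃ P ∈ 𝒬 x, 0 < (P : Measure Y) {y | F x y ∈ (O : Set H)}}),
        interior {h : H | ∀ z ∈ (O : Set H), ⟪h, z⟫ < 0} := by
  ext h
  simp only [mem_compl_iff, mem_gainCone, mem_iUnion, mem_ofPred_eq, exists_prop]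
  constructor
  · intro hno
    push Not at hno
    obtain ⟨P, hP, hpos⟩ := hno
    have hsub : {y | ⟪h, F x y⟫ < 0} ⊆ ⋃ O : {O : TopologicalSpace.countableBasis H //
        h ∈ interior {h : H | ∀ z ∈ (O : Set H), ⟪h, z⟫ < 0}}, {y | F x y ∈ (O.1 : Set H)} := by
      intro y hy
      have hopen : IsOpen {q : H × H | ⟪q.1, q.2⟫ < 0} :=
        isOpen_lt (continuous_fst.inner continuous_snd) continuous_const
      obtain ⟨U, V, hU, hV, hhU, hyV, hUV⟩ := isOpen_prod_iff.1 hopen h (F x y) hy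
      obtain ⟨O, hO, hyO, hOV⟩ :=
        (TopologicalSpace.isBasis_countableBasis H).exists_subset_of_mem_open hyV hV
      refine mem_iUnion.2 ⟨⟨⟨O, hO⟩, mem_interior.2 ⟨U, fun k hk z hz => ?_, hU, hhU⟩⟩, hyO⟩
      exact hUV (mk_mem_prod hk (hOV hz))
    by_contra! hall
    refine hpos (measure_mono_null hsub (measure_iUnion_null fun O => ?_))
    by_contra hO
    exact hall O.1 ⟨P, hP, pos_iff_ne_zero.2 hO⟩ O.2
  · rintro ⟨O, ⟨P, hP, hpos⟩, hO⟩ hall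
    refine hpos.ne' (measure_mono_null (fun y hy => ?_) (hall P hP))
    exact interior_subset hO _ hy

variable [TopologicalSpace X] [PolishSpace X] [MeasurableSpace X] [BorelSpace X]
  [TopologicalSpace Y] [PolishSpace Y] [BorelSpace Y]

/-- A countable family of universally measurable holdings in the cones that detects arbitrage: the
projections on the cone of the points of a dense sequence. They are dense in the cone, which is
closed, so the cone is symmetric as soon as it contains the opposites of these projections. -/
theorem exists_gainCone_sequence [FiniteDimensional ℝ H] [MeasurableSpace H] [BorelSpace H]
    (h𝒬 : AnalyticSet {p : X × ProbabilityMeasure Y | p.2 ∈ 𝒬 p.1})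
    {F : X → Y → H} (hF : Measurable fun z : X × Y => F z.1 z.2) :
    ∃ p : ℕ → X → H, (∀ n, Measurable[univSigma X] (p n)) ∧
      (∀ n x, p n x ∈ gainCone (𝒬 x) (F x)) ∧
      (∀ n, MeasurableSet[univSigma X] {x | -p n x ∈ gainCone (𝒬 x) (F x)}) ∧
      ∀ x, (∀ n, -p n x ∈ gainCone (𝒬 x) (F x)) →
        ∀ h ∈ gainCone (𝒬 x) (F x), -h ∈ gainCone (𝒬 x) (F x) := by
  have : ProperSpace H := FiniteDimensional.proper ℝ H
  let A : TopologicalSpace.countableBasis H → Set X := fun O =>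
    {x | ∃ P ∈ 𝒬 x, 0 < (P : Measure Y) {y | F x y ∈ (O : Set H)}}
  let V : TopologicalSpace.countableBasis H → Set H := fun O =>
    interior {h : H | ∀ z ∈ (O : Set H), ⟪h, z⟫ < 0}
  have hA : ∀ O, MeasurableSet[univSigma X] (A O) := fun O =>
    measurableSet_exists_pos h𝒬
      (hF (TopologicalSpace.isOpen_of_mem_countableBasis O.2).measurableSet)
  have hV : ∀ O, IsOpen (V O) := fun O => isOpen_interior
  have hK : ∀ x, (gainCone (𝒬 x) (F x))ᶜ = ⋃ O, ⋃ (_ : x ∈ A O), V O := compl_gainCone F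
  have hclosed : ∀ x, IsClosed (gainCone (𝒬 x) (F x)) := fun x => by
    rw [← isOpen_compl_iff, hK]
    exact isOpen_iUnion fun i => isOpen_iUnion fun _ => hV i
  have hcount : Countable (TopologicalSpace.countableBasis H) :=
    (TopologicalSpace.countable_countableBasis H).to_subtype
  choose p hp hpK hpmin using fun n => @exists_measurable_projection X _ (univSigma X) H A V
    (fun x => gainCone (𝒬 x) (F x)) _ _ _ _ _ _ hA hV hK (fun x => convex_gainCone)
    (fun x => ⟨0, zero_mem_gainCone⟩) (TopologicalSpace.denseSeq H n)
  refine ⟨p, hp, hpK, fun n => ?_, fun x hx h hh => ?_⟩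
  · have : {x | -p n x ∈ gainCone (𝒬 x) (F x)} =
        (⋃ O, (A O ∩ {x | p n x ∈ -V O}))ᶜ := by
      ext x
      rw [mem_ofPred_eq, ← notMem_compl_iff, hK]
      simp
    rw [this]
    refine @MeasurableSet.compl X _ (univSigma X) (@MeasurableSet.iUnion X _ (univSigma X) _ _
      fun O => @MeasurableSet.inter X (univSigma X) _ _ (hA O) (hp n ?_))
    exact (hV O).neg.measurableSet
  · have hcl : IsClosed {k | -k ∈ gainCone (𝒬 x) (F x)} := (hclosed x).preimage continuous_neg
    refine hcl.closure_subset (Metric.mem_closure_iff.2 fun ε hε => ?_)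
    obtain ⟨n, hn⟩ := (TopologicalSpace.denseRange_denseSeq H).exists_dist_lt h (half_pos hε)
    refine ⟨p n x, hx n, ?_⟩
    have h1 := hpmin n x h hh
    have h2 := dist_triangle_right h (p n x) (TopologicalSpace.denseSeq H n)
    linarith

end MeasurableCone

/-! ### Reduction to one period -/

section Reduction

theorem UnivKernel.ae_section_null {X : Type u} {Y : Type v} [MeasurableSpace X]
    [MeasurableSpace Y] {P : ProbabilityMeasure X} {q : UnivKernel X Y} {N : Set (X × Y)}
    (h : (UnivKernel.prod P q : Measure (X × Y)) N = 0) :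
    ∀ᵐ x ∂(P : Measure X), (q.toFun x : Measure Y) {y | (x, y) ∈ N} = 0 := by
  obtain ⟨M, hNM, hM, hM0⟩ := exists_measurable_superset_of_null h
  change UnivKernel.prodMeasure P q M = 0 at hM0
  rw [UnivKernel.prodMeasure_apply P q hM, lintegral_eq_zero_iff' (q.aemeasurable_section P hM)]
    at hM0
  filter_upwards [hM0] with x hx
  exact measure_mono_null (fun y hy => hNM hy) hx

theorem UnivKernel.prod_preimage_fst_eq_zero_iff {X : Type u} {Y : Type v} [MeasurableSpace X]
    [MeasurableSpace Y] {P : ProbabilityMeasure X} {q : UnivKernel X Y} {N : Set X} :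
    (UnivKernel.prod P q : Measure (X × Y)) {z | z.1 ∈ N} = 0 ↔ (P : Measure X) N = 0 := by
  constructor
  · intro h
    refine measure_mono_null (fun x hx => ?_) (ae_iff.1 (UnivKernel.ae_section_null h))
    simp [show x ∈ N from hx]
  · intro h
    obtain ⟨M, hNM, hM, hM0⟩ := exists_measurable_superset_of_null h
    refine measure_mono_null (t := Prod.fst ⁻¹' M) (fun z hz => hNM hz) ?_
    change UnivKernel.prodMeasure P q (Prod.fst ⁻¹' M) = 0
    rw [UnivKernel.prodMeasure_apply P q (measurable_fst hM),
      lintegral_eq_zero_iff' (q.aemeasurable_section P (measurable_fst hM))]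
    filter_upwards [measure_eq_zero_iff_ae_notMem.1 hM0] with x hx
    simp [hx]

variable {Ω : ℕ → Type u} {d : ℕ}

theorem portfolioValue_congr (S : ∀ t, Path Ω t → EuclideanSpace ℝ (Fin d)) (x : ℝ)
    {φ ψ : ∀ t, Path Ω t → EuclideanSpace ℝ (Fin d)} {t : ℕ} (h : ∀ s < t, φ s = ψ s)
    (ω : Path Ω t) : portfolioValue S x φ t ω = portfolioValue S x ψ t ω := by
  induction t with
  | zero => rfl
  | succ t ih =>
    obtain ⟨ω, w⟩ := ω
    simp only [portfolioValue]
    rw [ih (fun s hs => h s (hs.trans t.lt_succ_self)), h t t.lt_succ_self]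

variable [∀ n, MeasurableSpace (Ω n)]
  {𝒬 : ∀ t, Path Ω t → Set (ProbabilityMeasure (Ω t))}
  {S : ∀ t, Path Ω t → EuclideanSpace ℝ (Fin d)}

/-- A Borel strategy for the last period alone with quasi-surely non-negative gains cannot win. -/
theorem NoArbitrage.last_period {t : ℕ} (hNA : NoArbitrage (t + 1) 𝒬 S)
    (hF : Measurable fun z : Path Ω t × Ω t => increment S t z.1 z.2)
    {φ : Path Ω t → EuclideanSpace ℝ (Fin d)} (hφ : Measurable φ)
    (hcone : ∀ ω, φ ω ∈ gainCone (𝒬 t ω) (increment S t ω)) :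
    QuasiSurely (models 𝒬 (t + 1)) fun z => ⟪φ z.1, increment S t z.1 z.2⟫ = 0 := by
  let ψ : ∀ s, Path Ω s → EuclideanSpace ℝ (Fin d) := Function.update (fun _ _ => 0) t φ
  have hψt : ψ t = φ := Function.update_self ..
  have hψ : IsStrategy (t + 1) ψ := by
    intro s _
    rcases eq_or_ne s t with rfl | h
    · rw [hψt]
      exact hφ.mono (le_univSigma _) le_rfl
    · have : ψ s = fun _ => 0 := Function.update_of_ne h ..
      rw [this]
      exact @measurable_const _ _ _ (univSigma _) _
  have hzero : ∀ s (ω : Path Ω s), portfolioValue S 0 (fun _ _ => 0) s ω = 0 := by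
    intro s
    induction s with
    | zero => exact fun _ => rfl
    | succ s ih =>
      rintro ⟨ω, w⟩
      simp only [portfolioValue]
      rw [ih, inner_zero_left, add_zero]
  have hval : ∀ z : Path Ω (t + 1),
      portfolioValue S 0 ψ (t + 1) z = ⟪φ z.1, increment S t z.1 z.2⟫ := by
    rintro ⟨ω, w⟩
    simp only [portfolioValue]
    rw [hψt, portfolioValue_congr S 0 (ψ := fun _ _ => 0)
      (fun s hs => Function.update_of_ne hs.ne ..), hzero, zero_add]
  have hqs := hNA ψ hψ
  simp only [hval] at hqs
  refine hqs ?_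
  rintro _ ⟨Q, -, q, hq, rfl⟩
  have hm : MeasurableSet {z : Path Ω t × Ω t | ¬0 ≤ ⟪φ z.1, increment S t z.1 z.2⟫} := by
    simp only [not_le]
    exact measurableSet_lt ((hφ.comp measurable_fst).inner hF) measurable_const
  change UnivKernel.prodMeasure Q q _ = 0
  rw [UnivKernel.prodMeasure_apply Q q hm, lintegral_eq_zero_iff' (q.aemeasurable_section Q hm)]
  filter_upwards [hq] with ω hω
  exact hcone ω _ hω

variable [∀ n, TopologicalSpace (Ω n)] [∀ n, PolishSpace (Ω n)] [∀ n, BorelSpace (Ω n)]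

/-- Absence of arbitrage is inherited by a shorter horizon: a strategy may stop trading, and a model
for the shorter horizon extends to the longer one by measurable selection. -/
theorem NoArbitrage.of_succ {t : ℕ} (hne : ∀ ω, (𝒬 t ω).Nonempty)
    (han : AnalyticSet {p : Path Ω t × ProbabilityMeasure (Ω t) | p.2 ∈ 𝒬 t p.1})
    (hNA : NoArbitrage (t + 1) 𝒬 S) : NoArbitrage t 𝒬 S := by
  intro φ hφ hnonneg Q hQ
  let ψ : ∀ s, Path Ω s → EuclideanSpace ℝ (Fin d) := fun s ω => if s < t then φ s ω else 0
  have hψφ : ∀ s < t, ψ s = φ s := fun s hs => funext fun ω => if_pos hs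
  have hψ : IsStrategy (t + 1) ψ := by
    intro s _
    by_cases h : s < t
    · rw [hψφ s h]
      exact hφ s h
    · have : ψ s = fun _ => 0 := funext fun ω => if_neg h
      rw [this]
      exact @measurable_const _ _ _ (univSigma _) _
  have hval : ∀ (ω : Path Ω t) (w : Ω t),
      portfolioValue S 0 ψ (t + 1) (ω, w) = portfolioValue S 0 φ t ω := by
    intro ω w
    have h0 : ψ t ω = 0 := if_neg (lt_irrefl t)
    simp only [portfolioValue]
    rw [h0, inner_zero_left, add_zero, portfolioValue_congr S 0 hψφ]
  have : Nonempty (Path Ω t) := (Q : Measure (Path Ω t)).nonempty_of_neZero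
  obtain ⟨q, hq⟩ := exists_univKernel_mem han hne
  have hzero := hNA ψ hψ (by
    rintro _ ⟨Q', hQ', q', -, rfl⟩
    have hset : {z : Path Ω (t + 1) | ¬0 ≤ portfolioValue S 0 ψ (t + 1) z} =
        {z | z.1 ∈ {ω | ¬0 ≤ portfolioValue S 0 φ t ω}} := by
      ext ⟨ω, w⟩
      simp only [mem_ofPred_eq, hval]
    rw [hset]
    exact UnivKernel.prod_preimage_fst_eq_zero_iff.2 (hnonneg Q' hQ'))
    (UnivKernel.prod Q q) ⟨Q, hQ, q, .of_forall hq, rfl⟩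
  have hset : {z : Path Ω (t + 1) | ¬portfolioValue S 0 ψ (t + 1) z = 0} =
      {z | z.1 ∈ {ω | ¬portfolioValue S 0 φ t ω = 0}} := by
    ext ⟨ω, w⟩
    simp only [mem_ofPred_eq, hval]
  rw [hset] at hzero
  exact UnivKernel.prod_preimage_fst_eq_zero_iff.1 hzero

theorem NoArbitrage.of_le {s T : ℕ} (hQ : AnalyticModels T 𝒬) (hNA : NoArbitrage T 𝒬 S)
    (hs : s ≤ T) : NoArbitrage s 𝒬 S :=
  Nat.decreasingInduction' (P := fun s => NoArbitrage s 𝒬 S)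
    (fun k hk _ h => h.of_succ (hQ k hk).1 (hQ k hk).2.2) hs hNA

/-- A universally measurable choice of holdings in the cones has its opposite in the cones
quasi-surely. Otherwise it would be a Borel function on some Borel set of positive measure on which
its opposite is not in the cones; traded there, against measurably selected models under which it
wins with positive probability, it would be an arbitrage. -/
theorem isPolar_neg_notMem_gainCone {t : ℕ} (hne : ∀ ω, (𝒬 t ω).Nonempty)
    (han : AnalyticSet {p : Path Ω t × ProbabilityMeasure (Ω t) | p.2 ∈ 𝒬 t p.1})
    (hNA : NoArbitrage (t + 1) 𝒬 S)
    (hF : Measurable fun z : Path Ω t × Ω t => increment S t z.1 z.2)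
    {p : Path Ω t → EuclideanSpace ℝ (Fin d)} (hp : Measurable[univSigma (Path Ω t)] p)
    (hcone : ∀ ω, p ω ∈ gainCone (𝒬 t ω) (increment S t ω))
    (hm : MeasurableSet[univSigma (Path Ω t)] {ω | -p ω ∈ gainCone (𝒬 t ω) (increment S t ω)}) :
    IsPolar (models 𝒬 t) {ω | -p ω ∈ gainCone (𝒬 t ω) (increment S t ω)}ᶜ := by
  intro Q hQ
  set N := {ω | -p ω ∈ gainCone (𝒬 t ω) (increment S t ω)}ᶜ
  have hpae : AEMeasurable p (Q : Measure (Path Ω t)) :=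
    NullMeasurable.aemeasurable fun B hB => hp hB Q
  have hNnull : NullMeasurableSet (N ∩ {ω | p ω = hpae.mk p ω}) (Q : Measure (Path Ω t)) :=
    (hm Q).compl.inter (nullMeasurableSet_eq_fun hpae hpae.measurable_mk.aemeasurable)
  obtain ⟨B, hBN, hB, hBae⟩ := hNnull.exists_measurable_subset_ae_eq
  have hNB : (Q : Measure (Path Ω t)) N = (Q : Measure (Path Ω t)) B := by
    rw [measure_congr hBae]
    refine measure_congr ?_
    filter_upwards [hpae.ae_eq_mk] with ω hω
    exact propext ⟨fun h => ⟨h, hω⟩, fun h => h.1⟩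
  let φ : Path Ω t → EuclideanSpace ℝ (Fin d) := B.indicator (hpae.mk p)
  have hφB : ∀ ω ∈ B, φ ω = p ω := fun ω hω => by
    rw [show φ ω = _ from indicator_of_mem hω _]
    exact (hBN hω).2.symm
  have hφ : Measurable φ := hpae.measurable_mk.indicator hB
  have hφcone : ∀ ω, φ ω ∈ gainCone (𝒬 t ω) (increment S t ω) := by
    intro ω
    by_cases hω : ω ∈ B
    · rw [hφB ω hω]
      exact hcone ω
    · rw [show φ ω = 0 from indicator_of_notMem hω _]
      exact zero_mem_gainCone
  have hzero := hNA.last_period hF hφ hφcone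
  let E : Set (Path Ω t × Ω t) := {z | 0 < ⟪φ z.1, increment S t z.1 z.2⟫}
  -- Adding all pairs over the complement of `B` makes every point subject to selection.
  let E' : Set (Path Ω t × Ω t) := E ∪ {z | z.1 ∉ B}
  have hE : MeasurableSet E :=
    measurableSet_lt measurable_const ((hφ.comp measurable_fst).inner hF)
  have hE' : MeasurableSet E' := hE.union (measurable_fst hB.compl)
  have hpos : ∀ ω, ∃ P ∈ 𝒬 t ω, 0 < (P : Measure (Ω t)) {w | (ω, w) ∈ E'} := by
    intro ω
    by_cases hω : ω ∈ B
    · have hno : -p ω ∉ gainCone (𝒬 t ω) (increment S t ω) := (hBN hω).1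
      rw [mem_gainCone] at hno
      push Not at hno
      obtain ⟨P, hP, hP0⟩ := hno
      refine ⟨P, hP, pos_iff_ne_zero.2 fun h => hP0 (measure_mono_null (fun w hw => ?_) h)⟩
      left
      simpa [E, hφB ω hω] using hw
    · refine (hne ω).imp fun P hP => ⟨hP, ?_⟩
      simp [E', hω]
  have : Nonempty (Path Ω t) := (Q : Measure (Path Ω t)).nonempty_of_neZero
  obtain ⟨q, hq⟩ := exists_univKernel_pos han hE' ⟨Classical.arbitrary _, hpos _⟩
  have hnull := UnivKernel.ae_section_null (hzero (UnivKernel.prod Q q)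
    ⟨Q, hQ, q, .of_forall fun ω => (hq ω (hpos ω)).1, rfl⟩)
  rw [hNB]
  refine measure_mono_null (fun ω hω => ?_) (ae_iff.1 hnull)
  intro h0
  refine (hq ω (hpos ω)).2.ne' (measure_mono_null (fun w hw => ?_) h0)
  rcases hw with hw | hw
  · exact (show 0 < ⟪φ ω, increment S t ω w⟫ from hw).ne'
  · exact absurd hω hw

end Reduction

end RobustMarket

theorem proposition2p2 (T d : ℕ) (Ω : ℕ → Type u)
    [∀ n, TopologicalSpace (Ω n)] [∀ n, PolishSpace (Ω n)]
    [∀ n, MeasurableSpace (Ω n)] [∀ n, BorelSpace (Ω n)]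
    (𝒬 : ∀ t, RobustMarket.Path Ω t → Set (ProbabilityMeasure (Ω t)))
    (S : ∀ t, RobustMarket.Path Ω t → EuclideanSpace ℝ (Fin d))
    (hNA : RobustMarket.NoArbitrage T 𝒬 S)
    (hQ : RobustMarket.AnalyticModels T 𝒬)
    (hS : ∀ t ≤ T, Measurable (S t)) :
    ∀ t < T, ∃ G : Set (RobustMarket.Path Ω t),
      MeasurableSet[RobustMarket.univSigma (RobustMarket.Path Ω t)] G ∧
      RobustMarket.IsPolar (RobustMarket.models 𝒬 t) Gᶜ ∧
      ∀ ω ∈ G,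
        RobustMarket.NoArbitrageAt 𝒬 S t ω ∧
        (∃ W : Submodule ℝ (EuclideanSpace ℝ (Fin d)),
          (W : Set (EuclideanSpace ℝ (Fin d))) = RobustMarket.supportHull 𝒬 S t ω) ∧
        ∃ α : ℝ, 0 < α ∧
          ∀ h ∈ RobustMarket.supportHull 𝒬 S t ω, h ≠ 0 →
            ∃ P ∈ 𝒬 t ω,
              α < (P : Measure (Ω t)).real
                {w | ⟪(1 / ‖h‖) • h, RobustMarket.increment S t ω w⟫ < -α} := by
  intro t ht
  obtain ⟨hne, -, han⟩ := hQ t ht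
  have hF : Measurable fun z : RobustMarket.Path Ω t × Ω t =>
      RobustMarket.increment S t z.1 z.2 :=
    (hS (t + 1) ht).sub ((hS t ht.le).comp measurable_fst)
  have hNA' := hNA.of_le hQ (Nat.succ_le_of_lt ht)
  obtain ⟨p, hp, hpK, hpm, hsymm⟩ := RobustMarket.exists_gainCone_sequence han hF
  refine ⟨⋂ n, {ω | -p n ω ∈ RobustMarket.gainCone (𝒬 t ω) (RobustMarket.increment S t ω)},
    @MeasurableSet.iInter _ _ (RobustMarket.univSigma _) _ _ hpm, fun Q hQt => ?_, fun ω hω => ?_⟩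
  · rw [compl_iInter, measure_iUnion_null_iff]
    exact fun n => RobustMarket.isPolar_neg_notMem_gainCone hne han hNA' hF (hp n) (hpK n) (hpm n)
      Q hQt
  · have hat : RobustMarket.NoArbitrageAt 𝒬 S t ω := fun h hh =>
      RobustMarket.quasiSurely_eq_zero hh (hsymm ω (mem_iInter.1 hω) h hh)
    have hZ : Measurable (RobustMarket.increment S t ω) := hF.comp measurable_prodMk_left
    refine ⟨hat, ⟨(RobustMarket.supportHull 𝒬 S t ω).direction, ?_⟩,
      RobustMarket.exists_uniform_loss hZ (hne ω) hat⟩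
    have h0 : (0 : EuclideanSpace ℝ (Fin d)) ∈ RobustMarket.supportHull 𝒬 S t ω :=
      RobustMarket.zero_mem_affineSpan_support hZ (hne ω) hat
    ext h
    rw [SetLike.mem_coe, SetLike.mem_coe, ← AffineSubspace.vsub_right_mem_direction_iff_mem h0 h,
      vsub_eq_sub, sub_zero]
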